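/- All graphs are finite and simple. Let $G$ be a graph and $S\subseteq V(G)$. First, all vertices of $S$ and all neighbours of vertices of $S$ are observed; then, repeatedly, every vertex that is the only unobserved neighbour of some observed vertex becomes observed. The set $S$ is a power dominating set of $G$ if every vertex of $G$ is eventually observed, and the power domination number $\gamma_P(G)$ is the smallest cardinality of a power dominating set of $G$. A graph is claw-free if it has no induced subgraph isomorphic to $K_{1,3}$, and diamond-free if it has no subgraph (induced or not) isomorphic to $K_4-e$, the graph $K_4$ with one edge deleted; for a connected cubic graph the latter means that it has no induced $K_4-e$ and is not $K_4$ itself. A graph is cubic if every vertex has degree $3$, and $2$-edge-connected if it is connected and remains so after the deletion of any single edge. Theorem. If $G$ is a $2$-edge-connected claw-free diamond-free cubic graph of order $n$, then $\gamma_P(G)\le \frac n6$. This bound is sharp: there is a $2$-edge-connected claw-free diamond-free cubic graph $G$ of order $12$ with $\gamma_P(G)=2=\frac{12}{6}$. -/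

import Mathlib

namespace SimpleGraph

/-- The claw `K_{1,3}`. -/
abbrev claw : SimpleGraph (Fin 1 ⊕ Fin 3) := completeBipartiteGraph (Fin 1) (Fin 3)

/-- The diamond `K_4 - e`. -/
abbrev diamond : SimpleGraph (Fin 4) := (completeGraph (Fin 4)).deleteEdges {s(0, 1)}

/-- `G` is claw-free: no induced subgraph of `G` is a claw. -/
def IsClawFree {V : Type*} (G : SimpleGraph V) : Prop := ¬ claw.IsIndContained G

/-- `G` is diamond-free: no subgraph of `G`, induced or not, is a diamond.
(For a connected cubic graph this says: no induced diamond, and `G` is not `K_4`.) -/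
def IsDiamondFree {V : Type*} (G : SimpleGraph V) : Prop := ¬ diamond.IsContained G

/-- The vertices of `G` that are eventually observed from `S` in power domination: the vertices
of `S` and their neighbours are observed (domination step), and a vertex `w` adjacent to an
observed vertex `v` all of whose other neighbours are observed becomes observed
(propagation step, repeated as often as needed). -/
inductive Observed {V : Type*} (G : SimpleGraph V) (S : Set V) : V → Prop
  | mem {v : V} (hv : v ∈ S) : Observed G S v
  | neighbor {v w : V} (hv : v ∈ S) (hvw : G.Adj v w) : Observed G S w
  | propagate {v w : V} (hv : Observed G S v) (hvw : G.Adj v w)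
      (h : ∀ u, G.Adj v u → u ≠ w → Observed G S u) : Observed G S w

/-- `S` is a power dominating set of `G`: every vertex is eventually observed. -/
def IsPowerDominating {V : Type*} (G : SimpleGraph V) (S : Set V) : Prop :=
  ∀ v, G.Observed S v

/-- The power domination number of a finite graph: the least cardinality of a power
dominating set (the set of all vertices is one). -/
noncomputable def powerDominationNumber {V : Type*} [Fintype V] (G : SimpleGraph V) : ℕ :=
  sInf {k | ∃ S : Finset V, S.card = k ∧ G.IsPowerDominating (S : Set V)}

end SimpleGraph

namespace SimpleGraph

/-! Every vertex lies in exactly one triangle and has one further neighbour, so contracting the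
triangles leaves a loopless cubic multigraph on `n / 3` vertices. In a maximum cut of it, each
triangle has at most one outer edge staying on its own side (`exists_coloring`). Choose one vertex
in each triangle of one side. That side is dominated, and propagation along outer edges crosses the
cut. A vertex still unobserved has its outer edge inside the other side, so its two triangle mates
are already observed and force it (`isPowerDominating_of_coloring`). The smaller side has at most `n
/ 6` triangles.

For sharpness, in the truncated tetrahedron the closed neighbourhood of any triangle is a proper set
that propagation cannot leave, so one vertex is not enough. -/

/-- A partition of the vertices into triangles, every vertex having exactly one neighbour outside
its own triangle. -/
structure TrianglePartition {V : Type*} [Fintype V] (G : SimpleGraph V) where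
  /-- Lying in the same triangle. -/
  same : Setoid V
  /-- The neighbour outside the triangle. -/
  outer : V → V
  outer_outer : ∀ v, outer (outer v) = v
  not_same_outer : ∀ v, ¬ same v (outer v)
  adj_outer : ∀ v, G.Adj v (outer v)
  adj_of_same : ∀ {u v}, same u v → u ≠ v → G.Adj u v
  same_or_outer : ∀ {u v}, G.Adj u v → same u v ∨ v = outer u
  card_fiber : ∀ v, Nat.card {u // same v u} = 3

/-! ### Local structure: triangles and outer neighbours -/

section Structure

variable {V : Type*} {G : SimpleGraph V}

theorem IsClawFree.exists_adj (hG : G.IsClawFree) {v x y z : V} (hx : G.Adj v x) (hy : G.Adj v y)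
    (hz : G.Adj v z) (hxy : x ≠ y) (hxz : x ≠ z) (hyz : y ≠ z) :
    G.Adj x y ∨ G.Adj x z ∨ G.Adj y z := by
  by_contra! h
  obtain ⟨h1, h2, h3⟩ := h
  have h1' := fun h : G.Adj y x => h1 h.symm
  have h2' := fun h : G.Adj z x => h2 h.symm
  have h3' := fun h : G.Adj z y => h3 h.symm
  refine hG ⟨⟨⟨Sum.elim (fun _ => v) ![x, y, z], ?_⟩, ?_⟩⟩
  · rintro (a | a) (b | b) h
    · exact congrArg _ (Subsingleton.elim _ _)
    · fin_cases b <;> simp at h <;> subst h <;> simp at *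
    · fin_cases a <;> simp at h <;> subst h <;> simp at *
    · fin_cases a <;> fin_cases b <;> simp_all
  · intro a b
    change G.Adj (Sum.elim (fun _ => v) ![x, y, z] a) (Sum.elim (fun _ => v) ![x, y, z] b) ↔ _
    rcases a with a | a <;> rcases b with b | b
    · simp
    · fin_cases b <;> simp [hx, hy, hz]
    · fin_cases a <;> simp [hx.symm, hy.symm, hz.symm]
    · fin_cases a <;> fin_cases b <;> simp_all

theorem IsDiamondFree.eq_of_common_adj (hG : G.IsDiamondFree) {u v x y : V} (huv : G.Adj u v)
    (hux : G.Adj u x) (hvx : G.Adj v x) (huy : G.Adj u y) (hvy : G.Adj v y) : x = y := by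
  by_contra hxy
  have h1 := huv.ne
  have h2 := hux.ne
  have h3 := hvx.ne
  have h4 := huy.ne
  have h5 := hvy.ne
  refine hG ⟨⟨⟨![x, y, u, v], ?_⟩, ?_⟩⟩
  · intro a b h
    fin_cases a <;> fin_cases b <;> simp_all [G.adj_comm]
  · intro a b h
    fin_cases a <;> fin_cases b <;> simp_all

/-- Claw-freeness forces an edge among the three neighbours of `v`; a second such edge would create
a diamond. -/
theorem exists_neighbors [Fintype V] [DecidableRel G.Adj] (hc : G.IsClawFree)
    (hd : G.IsDiamondFree) (hr : G.IsRegularOfDegree 3) (v : V) :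
    ∃ a b o, (∀ w, G.Adj v w ↔ w = a ∨ w = b ∨ w = o) ∧ a ≠ b ∧ G.Adj a b ∧
      ¬ G.Adj a o ∧ ¬ G.Adj b o := by
  classical
  obtain ⟨x, y, z, hxy, hxz, hyz, h⟩ := Finset.card_eq_three.mp (hr v)
  have hv : ∀ w, G.Adj v w ↔ w = x ∨ w = y ∨ w = z := fun w => by
    rw [← mem_neighborFinset, h]; simp
  have hx := (hv x).2 (by simp)
  have hy := (hv y).2 (by simp)
  have hz := (hv z).2 (by simp)
  rcases hc.exists_adj hx hy hz hxy hxz hyz with h | h | h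
  · exact ⟨x, y, z, hv, hxy, h, fun h' => hyz (hd.eq_of_common_adj hx hy h hz h'),
      fun h' => hxz (hd.eq_of_common_adj hy hx h.symm hz h')⟩
  · exact ⟨x, z, y, fun w => by rw [hv]; tauto, hxz, h,
      fun h' => hyz.symm (hd.eq_of_common_adj hx hz h hy h'),
      fun h' => hxy (hd.eq_of_common_adj hz hx h.symm hy h')⟩
  · exact ⟨y, z, x, fun w => by rw [hv]; tauto, hyz, h,
      fun h' => hxz.symm (hd.eq_of_common_adj hy hz h hx h'),
      fun h' => hxy.symm (hd.eq_of_common_adj hz hy h.symm hx h')⟩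

theorem nonempty_trianglePartition [Fintype V] [DecidableRel G.Adj] (hc : G.IsClawFree)
    (hd : G.IsDiamondFree) (hr : G.IsRegularOfDegree 3) : Nonempty G.TrianglePartition := by
  classical
  choose a b o hadj hab hadjab hao hbo using exists_neighbors hc hd hr
  have ha v : G.Adj v (a v) := (hadj v _).2 (by simp)
  have hb v : G.Adj v (b v) := (hadj v _).2 (by simp)
  have ho v : G.Adj v (o v) := (hadj v _).2 (by simp)
  -- Lying on a triangle is a symmetric property of an edge, so this makes the relation given by the
  -- chosen `a`, `b` symmetric.
  have hcommon {v w : V} (h : G.Adj v w) : (∃ x, G.Adj v x ∧ G.Adj w x) ↔ w = a v ∨ w = b v := by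
    constructor
    · rintro ⟨x, hvx, hwx⟩
      rcases (hadj v w).1 h with h | h | rfl
      · exact .inl h
      · exact .inr h
      · rcases (hadj v x).1 hvx with rfl | rfl | rfl
        · exact absurd hwx.symm (hao v)
        · exact absurd hwx.symm (hbo v)
        · exact absurd hwx G.irrefl
    · rintro (rfl | rfl)
      · exact ⟨b v, hb v, hadjab v⟩
      · exact ⟨a v, ha v, (hadjab v).symm⟩
  have hsymm {v w : V} (h : w = a v ∨ w = b v) : v = a w ∨ v = b w := by
    have hvw : G.Adj v w := (hadj v w).2 (by tauto)
    obtain ⟨x, h1, h2⟩ := (hcommon hvw).2 h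
    exact (hcommon hvw.symm).1 ⟨x, h2, h1⟩
  have hao' v : o v ≠ a v := fun h => hbo v (h ▸ (hadjab v).symm)
  have hbo' v : o v ≠ b v := fun h => hao v (h ▸ hadjab v)
  refine ⟨⟨⟨fun u v => v = u ∨ v = a u ∨ v = b u, ⟨fun _ => .inl rfl, ?_, ?_⟩⟩, o,
    ?_, ?_, ho, ?_, ?_, ?_⟩⟩
  · rintro u v (rfl | h)
    · exact .inl rfl
    · exact .inr (hsymm h)
  · rintro u v w (rfl | h) (rfl | h')
    · exact .inl rfl
    · exact .inr h'
    · exact .inr h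
    · by_cases hwu : w = u
      · exact .inl hwu
      have huv : G.Adj v u := (hadj v u).2 (by have := hsymm h; tauto)
      have hvw : G.Adj v w := (hadj v w).2 (by tauto)
      have huw : G.Adj u w := by
        rcases hsymm h with rfl | rfl <;> rcases h' with rfl | rfl
        · exact absurd rfl hwu
        · exact hadjab v
        · exact (hadjab v).symm
        · exact absurd rfl hwu
      exact .inr ((hcommon huw).1 ⟨v, huv.symm, hvw.symm⟩)
  · intro v
    rcases (hadj (o v) v).1 (ho v).symm with h | h | h
    · have := hsymm (.inl h)
      exact absurd this (by simp [hao', hbo'])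
    · have := hsymm (.inr h)
      exact absurd this (by simp [hao', hbo'])
    · exact h.symm
  · intro v
    change ¬ (o v = v ∨ o v = a v ∨ o v = b v)
    simp [hao', hbo', (ho v).ne']
  · rintro u v (rfl | h) huv
    · exact absurd rfl huv
    · exact (hadj u v).2 (by tauto)
  · intro u v h
    rcases (hadj u v).1 h with h | h | h
    · exact .inl (.inr (.inl h))
    · exact .inl (.inr (.inr h))
    · exact .inr h
  · intro v
    change Nat.card {u // u = v ∨ u = a v ∨ u = b v} = 3
    rw [Nat.card_eq_fintype_card, Fintype.card_subtype]
    refine Finset.card_eq_three.mpr ⟨v, a v, b v, (ha v).ne, (hb v).ne, hab v, ?_⟩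
    ext; simp

end Structure

/-! ### The maximum cut argument -/

namespace TrianglePartition

variable {V : Type*} [Fintype V] {G : SimpleGraph V} (P : G.TrianglePartition)

/-- A maximum cut of the triangles: at most one vertex of each triangle has its outer neighbour
on the same side. -/
theorem exists_coloring : ∃ c : V → Bool, (∀ u v, P.same u v → c u = c v) ∧
    ∀ x y, P.same x y → x ≠ y → c x = c (P.outer x) → c y ≠ c (P.outer y) := by
  classical
  -- Each outer edge inside a side is counted twice, once per end; minimising this count maximises
  -- the cut.
  let mono (c : V → Bool) : Finset V := {v | c v = c (P.outer v)}
  obtain ⟨c, hc, hmin⟩ := Set.exists_min_image {c : V → Bool | ∀ u v, P.same u v → c u = c v}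
    (fun c => (mono c).card) (Set.toFinite _) ⟨fun _ => true, fun _ _ _ => rfl⟩
  refine ⟨c, hc, fun x y hxy hne hx hy => ?_⟩
  -- Move the triangle of `x` across the cut. This toggles membership in `mono` exactly on `K`, the
  -- ends of its three outer edges. If `x` and `y` were both in `mono`, at least 4 of the at most 6
  -- elements of `K` would be replaced by at most 2, contradicting minimality.
  let c' : V → Bool := fun w => if P.same x w then !(c w) else c w
  have hc' : ∀ u v, P.same u v → c' u = c' v := by
    intro u v h
    have h1 : P.same x u ↔ P.same x v :=
      ⟨fun h' => P.same.trans h' h, fun h' => P.same.trans h' (P.same.symm h)⟩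
    simp only [c', h1, hc u v h]
  let q : Finset V := {w | P.same x w}
  have hq : q.card = 3 := by
    rw [← P.card_fiber x, Nat.card_eq_fintype_card, Fintype.card_subtype]
  let K := q ∪ q.image P.outer
  have hK : K.card ≤ 6 := by
    have h1 := Finset.card_union_le q (q.image P.outer)
    have h2 := Finset.card_image_le (s := q) (f := P.outer)
    change (q ∪ q.image P.outer).card ≤ 6
    omega
  have memK : ∀ w, w ∈ K ↔ P.same x w ∨ P.same x (P.outer w) := by
    intro w
    simp only [K, q, Finset.mem_union, Finset.mem_image, Finset.mem_filter, Finset.mem_univ,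
      true_and]
    refine or_congr_right ⟨?_, fun h => ⟨_, h, P.outer_outer w⟩⟩
    rintro ⟨z, h, rfl⟩
    rwa [P.outer_outer]
  have not_both : ∀ w, ¬ (P.same x w ∧ P.same x (P.outer w)) := fun w h =>
    P.not_same_outer w (P.same.trans (P.same.symm h.1) h.2)
  have hmono : mono c' = (mono c \ K) ∪ (K \ mono c) := by
    ext w
    have h := not_both w
    simp only [mono, c', Finset.mem_union, Finset.mem_sdiff, memK, Finset.mem_filter,
      Finset.mem_univ, true_and]
    by_cases h1 : P.same x w <;> by_cases h2 : P.same x (P.outer w) <;>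
      cases c w <;> cases c (P.outer w) <;> simp_all
  have hxx : P.same x x := P.same.refl x
  have hsub : ({x, y, P.outer x, P.outer y} : Finset V) ⊆ K ∩ mono c := by
    intro w hw
    simp only [Finset.mem_insert, Finset.mem_singleton] at hw
    simp only [Finset.mem_inter, memK, mono, Finset.mem_filter, Finset.mem_univ, true_and]
    rcases hw with rfl | rfl | rfl | rfl <;> simp_all [P.outer_outer]
  have hcard : ({x, y, P.outer x, P.outer y} : Finset V).card = 4 := by
    have h1 : x ≠ P.outer x := (P.adj_outer x).ne
    have h2 : y ≠ P.outer y := (P.adj_outer y).ne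
    have h3 : x ≠ P.outer y := fun h => P.not_same_outer y (h ▸ P.same.symm hxy)
    have h4 : y ≠ P.outer x := fun h => P.not_same_outer x (h ▸ hxy)
    have h5 : P.outer x ≠ P.outer y := fun h => hne <| by
      rw [← P.outer_outer x, h, P.outer_outer]
    rw [Finset.card_insert_of_notMem, Finset.card_insert_of_notMem, Finset.card_pair h5] <;>
      simp [*]
  have h1 := Finset.card_le_card hsub
  have h2 := Finset.card_union_le (mono c \ K) (K \ mono c)
  have h3 := hmin c' hc'
  have h4 := Finset.card_sdiff_add_card_inter (mono c) K
  have h5 := Finset.card_sdiff_add_card_inter K (mono c)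
  rw [Finset.inter_comm] at h4
  simp only [hmono] at h3
  omega

/-- One vertex in each triangle on one side of a maximum cut is enough to observe everything. -/
theorem isPowerDominating_of_coloring {c : V → Bool} (hc : ∀ u v, P.same u v → c u = c v)
    (hcut : ∀ x y, P.same x y → x ≠ y → c x = c (P.outer x) → c y ≠ c (P.outer y))
    {S : Set V} {b : Bool} (hS : ∀ v, c v = b → ∃ s ∈ S, P.same s v) : G.IsPowerDominating S := by
  have hb : ∀ v, c v = b → G.Observed S v := by
    intro v hv
    obtain ⟨s, hs, h⟩ := hS v hv
    by_cases hsv : s = v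
    · exact .mem (hsv ▸ hs)
    · exact .neighbor hs (P.adj_of_same h hsv)
  have houter : ∀ v, c (P.outer v) = b → G.Observed S v := by
    intro v hv
    -- The outer neighbour of `v` is on the dominated side with its whole triangle, so `v` is all it
    -- can still have to force.
    refine .propagate (hb _ hv) (P.adj_outer v).symm fun u hu huv => ?_
    rcases P.same_or_outer hu with h | h
    · exact hb _ (hc _ _ h ▸ hv)
    · exact absurd (h.trans (P.outer_outer v)) huv
  intro v
  by_cases h1 : c v = b
  · exact hb v h1
  by_cases h2 : c (P.outer v) = b
  · exact houter v h2
  have h3 : c v = c (P.outer v) := by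
    rw [Bool.eq_not_of_ne h1, Bool.eq_not_of_ne h2]
  have hother : ∀ u, P.same v u → v ≠ u → c (P.outer u) = b := by
    intro u hu hne
    have h4 := hcut v u hu hne h3
    rw [← hc v u hu] at h4
    revert h1 h4
    cases c v <;> cases c (P.outer u) <;> cases b <;> simp
  obtain ⟨x, hvx, hne⟩ : ∃ x, P.same v x ∧ v ≠ x := by
    have : Nontrivial {u // P.same v u} := by
      rw [← Finite.one_lt_card_iff_nontrivial, P.card_fiber]; norm_num
    obtain ⟨⟨x, hx⟩, hne⟩ := exists_ne (⟨v, P.same.refl v⟩ : {u // P.same v u})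
    exact ⟨x, hx, fun h => hne (Subtype.ext h.symm)⟩
  -- The triangle mate `x` forces `v`: the third vertex of the triangle was reached across the cut,
  -- and the outer neighbour of `x` lies on the dominated side.
  refine .propagate (houter x (hother x hvx hne)) (P.adj_of_same hvx hne).symm fun u hu huv => ?_
  rcases P.same_or_outer hu with h | rfl
  · exact houter u (hother u (P.same.trans hvx h) huv.symm)
  · exact hb _ (hother x hvx hne)

theorem card_quotient : 3 * Nat.card (Quotient P.same) = Fintype.card V := by
  classical
  have h := Finset.card_eq_sum_card_fiberwise (f := (Quotient.mk P.same)) (s := Finset.univ)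
    (t := Finset.univ) (fun _ _ => Finset.mem_coe.2 (Finset.mem_univ _))
  rw [Finset.card_univ, Finset.sum_const_nat (m := 3)] at h
  · rw [h, Finset.card_univ, Nat.card_eq_fintype_card, mul_comm]
  · intro q _
    induction q using Quotient.inductionOn with
    | h v =>
      rw [← P.card_fiber v, Nat.card_eq_fintype_card, Fintype.card_subtype]
      congr 1
      ext u
      simp only [Finset.mem_filter, Finset.mem_univ, true_and]
      exact Quotient.eq.trans ⟨P.same.symm, P.same.symm⟩

theorem six_mul_powerDominationNumber_le (P : G.TrianglePartition) :
    6 * G.powerDominationNumber ≤ Fintype.card V := by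
  classical
  obtain ⟨c, hc, hcut⟩ := P.exists_coloring
  let T (b : Bool) : Finset (Quotient P.same) := {q | c q.out = b}
  have hle (b : Bool) : G.powerDominationNumber ≤ (T b).card := by
    have hcard : ((T b).image Quotient.out).card ≤ (T b).card := Finset.card_image_le
    refine le_trans (Nat.sInf_le ⟨(T b).image Quotient.out, rfl, ?_⟩) hcard
    refine P.isPowerDominating_of_coloring hc hcut (b := b) fun v hv => ?_
    have hs : P.same (Quotient.mk P.same v).out v := Quotient.mk_out v
    refine ⟨_, ?_, hs⟩
    rw [Finset.coe_image]
    exact ⟨_, by simpa [T] using (hc _ _ hs).trans hv, rfl⟩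
  have hsum : (T true).card + (T false).card = Nat.card (Quotient P.same) := by
    rw [Nat.card_eq_fintype_card, ← Finset.card_univ,
      ← Finset.card_filter_add_card_filter_not (s := Finset.univ)
        (fun q : Quotient P.same => c q.out = true)]
    simp [T]
  have h1 := hle true
  have h2 := hle false
  have h3 := P.card_quotient
  omega

end TrianglePartition

/-! ### Sharpness: the truncated tetrahedron -/

/-- The truncated tetrahedron: the Hamiltonian cycle `0, 1, …, 11` with the chords closing the
triangles `{3k, 3k + 1, 3k + 2}` and the two chords `1 – 7` and `4 – 10`. -/
def truncatedTetrahedron : SimpleGraph (Fin 12) where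
  Adj i j := i ≠ j ∧ (i.val / 3 = j.val / 3 ∨ j = i + 1 ∨ i = j + 1 ∨ (i.val % 3 = 1 ∧ j = i + 6))
  symm := ⟨by decide⟩
  loopless := ⟨by decide⟩

instance : DecidableRel truncatedTetrahedron.Adj := fun i j =>
  inferInstanceAs (Decidable (i ≠ j ∧ (_ ∨ _)))

namespace truncatedTetrahedron

theorem isRegularOfDegree : truncatedTetrahedron.IsRegularOfDegree 3 := by
  unfold IsRegularOfDegree
  decide

theorem isClawFree : truncatedTetrahedron.IsClawFree := by
  rintro ⟨f⟩
  have key : ∀ v x, truncatedTetrahedron.Adj v x → ∀ y, truncatedTetrahedron.Adj v y → x ≠ y →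
      ¬ truncatedTetrahedron.Adj x y → ∀ z, truncatedTetrahedron.Adj v z → x ≠ z → y ≠ z →
      ¬ truncatedTetrahedron.Adj x z → truncatedTetrahedron.Adj y z := by decide
  have h1 (i : Fin 3) : truncatedTetrahedron.Adj (f (.inl 0)) (f (.inr i)) := by
    rw [f.map_adj_iff]; simp
  have h2 (i j : Fin 3) (h : i ≠ j) : f (.inr i) ≠ f (.inr j) := by simpa using h
  have h3 (i j : Fin 3) : ¬ truncatedTetrahedron.Adj (f (.inr i)) (f (.inr j)) := by
    rw [f.map_adj_iff]; simp
  exact h3 1 2 (key _ _ (h1 0) _ (h1 1) (h2 0 1 (by decide)) (h3 0 1) _ (h1 2)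
    (h2 0 2 (by decide)) (h2 1 2 (by decide)) (h3 0 2))

theorem isDiamondFree : truncatedTetrahedron.IsDiamondFree := by
  rintro ⟨f⟩
  have key : ∀ u v, truncatedTetrahedron.Adj u v → ∀ x, truncatedTetrahedron.Adj u x →
      truncatedTetrahedron.Adj v x → ∀ y, truncatedTetrahedron.Adj u y →
      truncatedTetrahedron.Adj v y → x = y := by decide
  have h (i j : Fin 4) (h : diamond.Adj i j) : truncatedTetrahedron.Adj (f i) (f j) :=
    f.toHom.map_adj h
  have h01 := f.injective (key (f 2) (f 3) (h 2 3 (by simp)) (f 0) (h 2 0 (by simp))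
    (h 3 0 (by simp)) (f 1) (h 2 1 (by simp)) (h 3 1 (by simp)))
  exact absurd h01 (by decide)

theorem adj_add_one : ∀ i, truncatedTetrahedron.Adj i (i + 1) := by
  decide

/-- Deleting at most one edge from a graph with a Hamiltonian cycle leaves a Hamiltonian path. -/
theorem isEdgeConnected : truncatedTetrahedron.IsEdgeConnected 2 := by
  intro u v s hs
  obtain ⟨j, hj⟩ : ∃ j : Fin 12, ∀ i, i ≠ j → s(i, i + 1) ∉ s := by
    by_cases h : ∃ j : Fin 12, s(j, j + 1) ∈ s
    · obtain ⟨j, hj⟩ := h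
      refine ⟨j, fun i hij hi => hij ?_⟩
      have hs' : s.encard ≤ 1 := (ENat.lt_add_one_iff (by simp)).1 (by rwa [one_add_one_eq_two])
      have := Set.encard_le_one_iff.1 hs' _ _ hi hj
      clear hi hj hij hs hs'
      revert i j
      decide
    · push Not at h
      -- No cycle edge is deleted, so the cycle may be cut open anywhere.
      exact ⟨0, fun i _ => h i⟩
  have step (i : Fin 12) (hi : i ≠ j) :
      (truncatedTetrahedron.deleteEdges s).Reachable i (i + 1) := by
    refine Adj.reachable ?_
    rw [deleteEdges_adj]
    exact ⟨adj_add_one i, hj i hi⟩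
  -- Walk the path from `j + 1` round to `j`; the bound on `k` stops it before the edge from `j` to
  -- `j + 1`.
  have key : ∀ k : ℕ, k < 12 →
      (truncatedTetrahedron.deleteEdges s).Reachable (j + 1) (j + 1 + Fin.ofNat 12 k) := by
    intro k
    induction k with
    | zero => intro _; simp
    | succ k ih =>
      intro hk
      have h := step (j + 1 + Fin.ofNat 12 k) (by
        intro h
        have := congrArg Fin.val h
        simp only [Fin.val_add, Fin.ofNat, Fin.val_one] at this
        omega)
      convert (ih (by omega)).trans h using 1
      ext
      simp [Fin.val_add, Fin.ofNat]
      omega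
  have all (w : Fin 12) : (truncatedTetrahedron.deleteEdges s).Reachable (j + 1) w := by
    convert key (w - (j + 1)).val (w - (j + 1)).isLt
    simp
  exact (all u).symm.trans (all v)

theorem not_isPowerDominating_of_subset_singleton {S : Set (Fin 12)} {v : Fin 12}
    (hS : S ⊆ {v}) : ¬ truncatedTetrahedron.IsPowerDominating S := by
  -- The closed neighbourhood of the triangle of `v` is a trap: a member with one neighbour outside
  -- has a second one outside, so it never forces.
  let X (w : Fin 12) : Prop := w.val / 3 = v.val / 3 ∨
    ∃ u, truncatedTetrahedron.Adj w u ∧ u.val / 3 = v.val / 3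
  have hX : ∀ w, truncatedTetrahedron.Observed S w → X w := by
    intro w hw
    induction hw with
    | mem h => rw [hS h]; exact .inl rfl
    | neighbor h hvw => rw [hS h] at hvw; exact .inr ⟨v, hvw.symm, rfl⟩
    | @propagate x w _ hxw _ ihx ih =>
      by_contra hw
      have key : ∀ v x w : Fin 12, truncatedTetrahedron.Adj x w →
          (x.val / 3 = v.val / 3 ∨ ∃ u, truncatedTetrahedron.Adj x u ∧ u.val / 3 = v.val / 3) →
          ¬ (w.val / 3 = v.val / 3 ∨ ∃ u, truncatedTetrahedron.Adj w u ∧ u.val / 3 = v.val / 3) →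
          ∃ u, truncatedTetrahedron.Adj x u ∧ u ≠ w ∧
          ¬ (u.val / 3 = v.val / 3 ∨
            ∃ t, truncatedTetrahedron.Adj u t ∧ t.val / 3 = v.val / 3) := by decide
      obtain ⟨u, hu, hne, hn⟩ := key v x w hxw ihx hw
      exact hn (ih u hu hne)
  intro h
  have key : ∀ v : Fin 12, ¬ ∀ w : Fin 12, w.val / 3 = v.val / 3 ∨
      ∃ u, truncatedTetrahedron.Adj w u ∧ u.val / 3 = v.val / 3 := by decide
  exact key v fun w => hX w (h w)

theorem two_le_powerDominationNumber : 2 ≤ truncatedTetrahedron.powerDominationNumber := by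
  refine le_csInf ⟨_, Finset.univ, rfl, fun v => .mem (by simp)⟩ ?_
  rintro k ⟨S, rfl, hS⟩
  by_contra! h
  obtain ⟨v, hv⟩ := Finset.card_le_one_iff_subset_singleton.1 (Nat.lt_succ_iff.1 h)
  exact not_isPowerDominating_of_subset_singleton (v := v) (by exact_mod_cast hv) hS

end truncatedTetrahedron

/-- Claw-free diamond-free cubic graphs have power domination number at most a sixth of their
order. -/
theorem powerDominationNumber_le_card_div_six {V : Type*} [Fintype V] {G : SimpleGraph V}
    [DecidableRel G.Adj] (hc : G.IsClawFree) (hd : G.IsDiamondFree)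
    (hr : G.IsRegularOfDegree 3) : (G.powerDominationNumber : ℚ) ≤ (Fintype.card V : ℚ) / 6 := by
  obtain ⟨P⟩ := nonempty_trianglePartition hc hd hr
  rw [le_div_iff₀ (by norm_num), mul_comm]
  exact_mod_cast P.six_mul_powerDominationNumber_le

end SimpleGraph

/-- The bound holds for every 2-edge-connected claw-free diamond-free cubic graph, and a graph
of this kind on 12 vertices attains it. -/
theorem theorem2p7 :
    (∀ {V : Type*} [Fintype V] (G : SimpleGraph V) [DecidableRel G.Adj],
      G.IsEdgeConnected 2 → G.IsClawFree → G.IsDiamondFree → G.IsRegularOfDegree 3 →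
        (G.powerDominationNumber : ℚ) ≤ (Fintype.card V : ℚ) / 6) ∧
    (∃ (G : SimpleGraph (Fin 12)) (_ : DecidableRel G.Adj),
      G.IsEdgeConnected 2 ∧ G.IsClawFree ∧ G.IsDiamondFree ∧ G.IsRegularOfDegree 3 ∧
        (G.powerDominationNumber : ℚ) = (Fintype.card (Fin 12) : ℚ) / 6) := by
  refine ⟨fun G _ _ hc hd hr => SimpleGraph.powerDominationNumber_le_card_div_six hc hd hr, ?_⟩
  open SimpleGraph.truncatedTetrahedron in
  refine ⟨SimpleGraph.truncatedTetrahedron, inferInstance, isEdgeConnected, isClawFree,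
    isDiamondFree, isRegularOfDegree, le_antisymm
      (SimpleGraph.powerDominationNumber_le_card_div_six isClawFree isDiamondFree
        isRegularOfDegree) ?_⟩
  have h : (2 : ℚ) ≤ SimpleGraph.truncatedTetrahedron.powerDominationNumber := by
    exact_mod_cast two_le_powerDominationNumber
  rw [Fintype.card_fin]
  norm_num
  exact_mod_cast h
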